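/- Let $k$ be a field and let $Q$ be a quiver with finite vertex set $Q_0$ and finite arrow set $Q_1$, connected (in particular nonempty) and without oriented cycles other than the vertices (paths of length zero). Let $Z$ be a minimal set of paths of length at least $2$: no path of $Z$ has a strict sub-path belonging to $Z$. Let $\langle Z\rangle$ be the two-sided ideal of the path algebra $kQ$ generated by $Z$, and let $B$ be the set of paths of $Q$ (including the vertices) which contain no path of $Z$ as a sub-path. Let $Q_1//B$ be the set of pairs $(a,\varepsilon)$ where $a\in Q_1$ and $\varepsilon\in B$ have the same source and the same target. Such a pair is *glued* if $a$ is the first or the last arrow of $\varepsilon$, or if $a$ is a loop and $\varepsilon$ is the vertex of this loop. It is *effective* if it is not glued and there is a path $\gamma\in Z$ containing $a$ such that the path obtained by replacing $a$ by $\varepsilon$ inside $\gamma$ belongs to $B$. Let $(Q_1//B)_{ne}$ be the set of pairs of $Q_1//B$ that are not effective. For a $k$-algebra $\Lambda$ and a $\Lambda$-bimodule $X$ on which $k$ acts centrally, let $H^1(\Lambda,X)$ be the first Hochschild cohomology space, that is the quotient of the space of derivations ($k$-linear maps $f:\Lambda\to X$ with $f(\lambda\mu)=\lambda f(\mu)+f(\lambda)\mu$)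 by the subspace of inner derivations ($\lambda\mapsto \lambda x-x\lambda$ with $x\in X$). Then $(Q_1//B)_{ne}$ is finite, $H^1(kQ/\langle Z\rangle,kQ/\langle Z\rangle)$ is finite dimensional over $k$, and $$\dim_k H^1(kQ/\langle Z\rangle,kQ/\langle Z\rangle)=1-|Q_0|+|(Q_1//B)_{ne}|.$$ -/

import Mathlib

/-! ### First Hochschild cohomology -/

section Hochschild

/-! Here `A` is an algebra over the field `k` and `X` is an `A`-bimodule on which `k` acts
centrally. The right action of `a` on `x` is written `MulOpposite.op a • x`. -/

variable (k : Type*) (A : Type*) (X : Type*) [Field k] [Ring A] [Algebra k A]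
  [AddCommGroup X] [Module k X] [Module A X] [Module Aᵐᵒᵖ X] [SMulCommClass A Aᵐᵒᵖ X]
  [IsScalarTower k A X] [IsScalarTower k Aᵐᵒᵖ X]

/-- The space of derivations of `A` with values in the bimodule `X`, that is of the `k`-linear maps
`f : A → X` with `f (a b) = a f(b) + f(a) b`. -/
def derivationSpace : Submodule k (A →ₗ[k] X) where
  carrier := {f | ∀ a b : A, f (a * b) = a • f b + MulOpposite.op b • f a}
  zero_mem' := by intro a b; simp
  add_mem' := by
    intro f g hf hg a b
    simp only [Set.mem_ofPred_eq, LinearMap.add_apply] at *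
    rw [hf, hg, smul_add, smul_add]
    abel
  smul_mem' := by
    intro c f hf a b
    have h₁ : a • c • f b = c • a • f b := by
      rw [← algebraMap_smul A c (f b), ← algebraMap_smul A c (a • f b), ← mul_smul, ← mul_smul,
        Algebra.commutes]
    have h₂ : MulOpposite.op b • c • f a = c • MulOpposite.op b • f a := by
      rw [← algebraMap_smul Aᵐᵒᵖ c (f a), ← algebraMap_smul Aᵐᵒᵖ c (MulOpposite.op b • f a),
        ← mul_smul, ← mul_smul, Algebra.commutes]
    simp only [LinearMap.smul_apply]
    rw [hf, smul_add, h₁, h₂]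

/-- The subspace of the inner derivations `a ↦ a x - x a`, where `x` is in `X`. -/
def innerDerivations : Submodule k (derivationSpace k A X) where
  carrier := {f | ∃ x : X, ∀ a : A, f.1 a = a • x - MulOpposite.op a • x}
  zero_mem' := ⟨0, by simp⟩
  add_mem' := by
    rintro f g ⟨x, hx⟩ ⟨y, hy⟩
    refine ⟨x + y, fun a => ?_⟩
    simp only [Submodule.coe_add, LinearMap.add_apply, hx, hy, smul_add]
    abel
  smul_mem' := by
    rintro c f ⟨x, hx⟩
    refine ⟨c • x, fun a => ?_⟩
    have h₁ : a • c • x = c • a • x := by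
      rw [← algebraMap_smul A c x, ← algebraMap_smul A c (a • x), ← mul_smul, ← mul_smul,
        Algebra.commutes]
    have h₂ : MulOpposite.op a • c • x = c • MulOpposite.op a • x := by
      rw [← algebraMap_smul Aᵐᵒᵖ c x, ← algebraMap_smul Aᵐᵒᵖ c (MulOpposite.op a • x),
        ← mul_smul, ← mul_smul, Algebra.commutes]
    simp only [Submodule.coe_smul, LinearMap.smul_apply, hx, smul_sub, h₁, h₂]

/-- The first Hochschild cohomology space `H¹(A, X)`: derivations modulo inner derivations. -/
def HochschildH1 : Type _ := derivationSpace k A X ⧸ innerDerivations k A X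

instance : AddCommGroup (HochschildH1 k A X) :=
  inferInstanceAs (AddCommGroup (derivationSpace k A X ⧸ innerDerivations k A X))

instance : Module k (HochschildH1 k A X) :=
  inferInstanceAs (Module k (derivationSpace k A X ⧸ innerDerivations k A X))

theorem mem_derivationSpace (f : A →ₗ[k] X) : f ∈ derivationSpace k A X ↔
    ∀ a b : A, f (a * b) = a • f b + MulOpposite.op b • f a := Iff.rfl

/-- Every `x` in `X` does define a derivation `a ↦ a x - x a`. -/
theorem exists_mem_innerDerivations (x : X) : ∃ f ∈ innerDerivations k A X,
    ∀ a : A, f.1 a = a • x - MulOpposite.op a • x := by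
  refine ⟨⟨{ toFun := fun a => a • x - MulOpposite.op a • x, map_add' := ?_, map_smul' := ?_ },
    ?_⟩, ⟨x, fun a => rfl⟩, fun a => rfl⟩
  · intro a b
    simp only [add_smul, MulOpposite.op_add]
    abel
  · intro c a
    simp only [MulOpposite.op_smul, smul_assoc, smul_sub, RingHom.id_apply]
  · intro a b
    simp only [LinearMap.coe_mk, AddHom.coe_mk, MulOpposite.op_mul, mul_smul, smul_sub,
      smul_comm a (MulOpposite.op b) x]
    abel

end Hochschild

/-! ### Paths and the path algebra -/

/-- A path of a quiver, with its source and its target. -/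
@[ext]
structure QPath (V : Type*) [Quiver V] where
  source : V
  target : V
  path : Quiver.Path source target

namespace QPath

variable {V : Type*} [Quiver V]

/-- The path of length zero at a vertex. -/
def vertex (x : V) : QPath V := ⟨x, x, Quiver.Path.nil⟩

/-- `p.Contains z`: the path `z` is a sub-path of `p`, that is `p` is the concatenation of some
path `u`, then `z`, then some path `v`. -/
def Contains (p z : QPath V) : Prop :=
  ∃ (u : Quiver.Path p.source z.source) (v : Quiver.Path z.target p.target),
    p.path = (u.comp z.path).comp v

end QPath

/-- The path algebra `kQ`: finite linear combinations of paths. -/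
def PathAlgebra (k : Type*) (V : Type*) [Field k] [Quiver V] : Type _ := QPath V →₀ k

namespace PathAlgebra

variable (k : Type*) {V : Type*} [Field k] [Quiver V]

noncomputable instance : AddCommGroup (PathAlgebra k V) :=
  inferInstanceAs (AddCommGroup (QPath V →₀ k))

noncomputable instance : Module k (PathAlgebra k V) :=
  inferInstanceAs (Module k (QPath V →₀ k))

/-- A path as an element of the path algebra. -/
noncomputable def ofPath (p : QPath V) : PathAlgebra k V := Finsupp.single p (1 : k)

/-- The paths form a basis of the path algebra. -/
noncomputable def basis : Module.Basis (QPath V) k (PathAlgebra k V) :=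
  Module.Basis.ofRepr (LinearEquiv.refl k (QPath V →₀ k))

theorem basis_apply (p : QPath V) : basis k p = ofPath k p := rfl

open Classical in
/-- The product `p q` of two paths: the path `q` followed by the path `p` if `q` ends where `p`
starts, and `0` otherwise. (So that `y (kQ) x` is spanned by the paths from `x` to `y`.) -/
noncomputable def pathMul (p q : QPath V) : PathAlgebra k V :=
  if h : q.target = p.source then
    ofPath k ⟨q.source, p.target, (q.path.cast rfl h).comp p.path⟩
  else 0

/-- The bilinear extension of the product of paths. -/
noncomputable def mulHom : PathAlgebra k V →ₗ[k] PathAlgebra k V →ₗ[k] PathAlgebra k V :=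
  (basis k).constr k fun p => (basis k).constr k fun q => pathMul k p q

noncomputable instance : Mul (PathAlgebra k V) := ⟨fun f g => mulHom k f g⟩

theorem mul_def (f g : PathAlgebra k V) : f * g = mulHom k f g := rfl

theorem ofPath_mul (p q : QPath V) : ofPath k p * ofPath k q = pathMul k p q := by
  rw [mul_def, ← basis_apply, ← basis_apply, mulHom, Module.Basis.constr_basis,
    Module.Basis.constr_basis]

theorem ofPath_mul_comp {x y z : V} (p : Quiver.Path y z) (q : Quiver.Path x y) :
    ofPath k ⟨y, z, p⟩ * ofPath k ⟨x, y, q⟩ = ofPath k ⟨x, z, q.comp p⟩ := by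
  rw [ofPath_mul, pathMul, dif_pos rfl]
  rfl

theorem ofPath_mul_of_ne {p q : QPath V} (h : q.target ≠ p.source) :
    ofPath k p * ofPath k q = 0 := by
  rw [ofPath_mul, pathMul, dif_neg h]

/-- The unit of the path algebra is the sum of the vertices. -/
noncomputable instance [Fintype V] : One (PathAlgebra k V) :=
  ⟨∑ x : V, ofPath k (QPath.vertex x)⟩

theorem one_def [Fintype V] :
    (1 : PathAlgebra k V) = ∑ x : V, ofPath k (QPath.vertex x) := rfl

theorem ofPath_mul_assoc (p q r : QPath V) :
    ofPath k p * ofPath k q * ofPath k r = ofPath k p * (ofPath k q * ofPath k r) := by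
  have zl (f : PathAlgebra k V) : 0 * f = 0 := by simp [mul_def]
  have zr (f : PathAlgebra k V) : f * 0 = 0 := by simp [mul_def]
  obtain ⟨p₀, p₁, p⟩ := p
  obtain ⟨q₀, q₁, q⟩ := q
  obtain ⟨r₀, r₁, r⟩ := r
  by_cases h₁ : q₁ = p₀
  · subst h₁
    by_cases h₂ : r₁ = q₀
    · subst h₂
      simp only [ofPath_mul_comp, Quiver.Path.comp_assoc]
    · rw [ofPath_mul_comp, ofPath_mul_of_ne k (p := ⟨q₀, _, q⟩) (q := ⟨r₀, r₁, r⟩) h₂, zr]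
      exact ofPath_mul_of_ne k h₂
  · rw [ofPath_mul_of_ne k (p := ⟨p₀, _, p⟩) (q := ⟨q₀, q₁, q⟩) h₁, zl]
    by_cases h₂ : r₁ = q₀
    · subst h₂
      rw [ofPath_mul_comp]
      exact (ofPath_mul_of_ne k (p := ⟨p₀, _, p⟩) h₁).symm
    · rw [ofPath_mul_of_ne k (p := ⟨q₀, _, q⟩) (q := ⟨r₀, r₁, r⟩) h₂, zr]

theorem induction_on {P : PathAlgebra k V → Prop} (f : PathAlgebra k V) (zero : P 0)
    (add : ∀ f g, P f → P g → P (f + g)) (smul : ∀ (c : k) (p : QPath V), P (c • ofPath k p)) :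
    P f := by
  refine Finsupp.induction_linear (motive := P) f zero add fun p c => ?_
  have h : (Finsupp.single p c : QPath V →₀ k) = c • Finsupp.single p (1 : k) := by simp
  exact h ▸ smul c p

theorem mul_assoc' (f g h : PathAlgebra k V) : f * g * h = f * (g * h) := by
  refine induction_on (P := fun f => f * g * h = f * (g * h)) k f ?_ ?_ fun a p => ?_
  · simp only [mul_def, map_zero, LinearMap.zero_apply]
  · intro f₁ f₂ h₁ h₂
    simp only [mul_def, map_add, LinearMap.add_apply] at *
    rw [h₁, h₂]
  refine induction_on (P := fun g => _ * g * h = _ * (g * h)) k g ?_ ?_ fun b q => ?_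
  · simp only [mul_def, map_zero, LinearMap.zero_apply]
  · intro f₁ f₂ h₁ h₂
    simp only [mul_def, map_add, LinearMap.add_apply] at *
    rw [h₁, h₂]
  refine induction_on (P := fun h => _ * _ * h = _ * (_ * h)) k h ?_ ?_ fun c r => ?_
  · simp only [mul_def, map_zero]
  · intro f₁ f₂ h₁ h₂
    simp only [mul_def, map_add] at *
    rw [h₁, h₂]
  have := ofPath_mul_assoc k p q r
  simp only [mul_def, map_smul, LinearMap.smul_apply] at *
  rw [this]

theorem one_mul' [Fintype V] (f : PathAlgebra k V) : 1 * f = f := by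
  classical
  refine induction_on (P := fun f => 1 * f = f) k f ?_ ?_ fun c p => ?_
  · simp only [mul_def, map_zero]
  · intro f₁ f₂ h₁ h₂
    simp only [mul_def, map_add] at *
    rw [h₁, h₂]
  have h : mulHom k 1 (ofPath k p) = ofPath k p := by
    rw [one_def, map_sum, LinearMap.sum_apply, Finset.sum_eq_single p.target]
    · exact ofPath_mul_comp k Quiver.Path.nil p.path
    · intro x _ hx
      exact ofPath_mul_of_ne k (Ne.symm hx)
    · simp
  rw [mul_def, map_smul, h]

theorem mul_one' [Fintype V] (f : PathAlgebra k V) : f * 1 = f := by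
  classical
  refine induction_on (P := fun f => f * 1 = f) k f ?_ ?_ fun c p => ?_
  · simp only [mul_def, map_zero, LinearMap.zero_apply]
  · intro f₁ f₂ h₁ h₂
    simp only [mul_def, map_add, LinearMap.add_apply] at *
    rw [h₁, h₂]
  have h : mulHom k (ofPath k p) 1 = ofPath k p := by
    rw [one_def, map_sum, Finset.sum_eq_single p.source]
    · refine (ofPath_mul_comp k p.path Quiver.Path.nil).trans ?_
      rw [Quiver.Path.nil_comp]
    · intro x _ hx
      exact ofPath_mul_of_ne k hx
    · simp
  rw [mul_def, map_smul, LinearMap.smul_apply, h]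

noncomputable instance [Fintype V] : Ring (PathAlgebra k V) where
  __ := (inferInstance : AddCommGroup (PathAlgebra k V))
  mul_assoc := mul_assoc' k
  one_mul := one_mul' k
  mul_one := mul_one' k
  zero_mul f := by simp only [mul_def, map_zero, LinearMap.zero_apply]
  mul_zero f := by simp only [mul_def, map_zero]
  left_distrib f g h := by simp only [mul_def, map_add]
  right_distrib f g h := by simp only [mul_def, map_add, LinearMap.add_apply]

noncomputable instance [Fintype V] : Algebra k (PathAlgebra k V) :=
  Algebra.ofModule
    (fun c f g => by simp only [mul_def, map_smul, LinearMap.smul_apply])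
    (fun c f g => by simp only [mul_def, map_smul])

end PathAlgebra

/-- The monomial algebra `kQ / ⟨Z⟩`, where `⟨Z⟩` is the two-sided ideal generated by the set of
paths `Z`. -/
abbrev MonomialAlgebra (k : Type*) {V : Type*} [Field k] [Quiver V] [Fintype V]
    (Z : Set (QPath V)) : Type _ :=
  (TwoSidedIdeal.span (PathAlgebra.ofPath k '' Z)).ringCon.Quotient

/-! ### Conditions on the quiver and on the set of paths -/

/-- A quiver is connected if it is nonempty and any two vertices are joined by a zigzag of
arrows. -/
def QuiverConnected (V : Type*) [Quiver V] : Prop :=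
  Nonempty V ∧ ∀ x y : V, Nonempty (@Quiver.Path (Quiver.Symmetrify V) _ x y)

/-- A quiver has no oriented cycles (other than the vertices). -/
def NoOrientedCycles (V : Type*) [Quiver V] : Prop :=
  ∀ (x : V) (p : Quiver.Path x x), p = Quiver.Path.nil

/-- A set `Z` of paths is minimal if no path of `Z` has a strict sub-path which is in `Z`. -/
def MinimalPaths {V : Type*} [Quiver V] (Z : Set (QPath V)) : Prop :=
  ∀ p ∈ Z, ∀ z ∈ Z, p.Contains z → z = p

/-- The set `B` of the paths which do not contain any path of `Z`. -/
def avoidingPaths {V : Type*} [Quiver V] (Z : Set (QPath V)) : Set (QPath V) :=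
  {p | ∀ z ∈ Z, ¬ p.Contains z}

/-! ### Parallel pairs -/

/-- A pair `(a, ε)` consisting of an arrow `a` and a path `ε` parallel to `a`. -/
structure ParallelPair (V : Type*) [Quiver V] where
  source : V
  target : V
  arrow : source ⟶ target
  path : Quiver.Path source target

namespace ParallelPair

variable {V : Type*} [Quiver V]

/-- The set `Q₁ // B` of the pairs `(a, ε)` with `a` an arrow and `ε ∈ B` a path parallel to `a`. -/
def ofAvoiding (Z : Set (QPath V)) : Set (ParallelPair V) :=
  {c | (⟨c.source, c.target, c.path⟩ : QPath V) ∈ avoidingPaths Z}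

/-- The pair `(a, ε)` is glued if `a` is the first arrow of `ε`, or the last arrow of `ε`, or `a`
is a loop and `ε` is the vertex of the loop (a path of length zero parallel to `a` exists only if
`a` is a loop, and is then the vertex of this loop). -/
def Glued (c : ParallelPair V) : Prop :=
  (∃ v : Quiver.Path c.target c.target, c.path = c.arrow.toPath.comp v) ∨
  (∃ u : Quiver.Path c.source c.source, c.path = u.comp c.arrow.toPath) ∨
  c.path.length = 0

/-- The pair `(a, ε)` is effective if it is not glued and if there is a path `γ = u a v` in `Z`
such that the path `u ε v`, obtained by replacing `a` by `ε` inside `γ`, belongs to `B`. -/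
def Effective (Z : Set (QPath V)) (c : ParallelPair V) : Prop :=
  ¬ c.Glued ∧
  ∃ γ ∈ Z, ∃ (u : Quiver.Path γ.source c.source) (v : Quiver.Path c.target γ.target),
    γ.path = (u.comp c.arrow.toPath).comp v ∧
    (⟨γ.source, γ.target, (u.comp c.path).comp v⟩ : QPath V) ∈ avoidingPaths Z

/-- The set `(Q₁ // B)ₙₑ` of the non effective pairs of `Q₁ // B`. -/
def nonEffective (Z : Set (QPath V)) : Set (ParallelPair V) :=
  {c | c ∈ ofAvoiding Z ∧ ¬ c.Effective Z}

end ParallelPair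

/-! ### Paths in quivers without oriented cycles -/

section Paths

variable {V : Type*} [Quiver V]

/-! Write `A` for the monomial algebra and `S` for the space of derivations of `A` vanishing on the
vertices (`vertexKilling`). The formula is the dimension count of the exact sequence `0 → k → k^{Q₀}
→ S → H¹(A, A) → 0`, together with `S ≃ k^{(Q₁//B)ₙₑ}`.

The isomorphism (`arrowCoord_injective`, `arrowCoord_surjective`): the paths of `B` form a basis of
`A`, and `D ∈ S` is determined by its values on arrows, where `D a` is a combination of paths `ε ∈
B` parallel to `a`. If `γ = u a v` is in `Z` and `u ε v` in `B`, then applying `D` to `γ = 0` and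
reading the coordinate on `u ε v` kills the coefficient of `ε`. The other two Leibniz terms still
contain `u a` or `a v`, so by acyclicity they cannot produce `u ε v` when `ε ≠ a`. Conversely,
arbitrary coefficients on the non effective pairs define a derivation, because every term `u ε v` of
the Leibniz expansion of a `γ ∈ Z` is then zero in `A`.

The sequence: the vertices are orthogonal idempotents of sum `1`, so every derivation vanishes on
them after an inner correction (`vertexKillingToH1_surjective`). An inner derivation lies in `S`
when its element commutes with the vertices; acyclicity makes such an element a combination of
vertices (`ker_vertexKillingToH1`). By connectedness, only the constant combinations act trivially
(`ker_diagonalDerivation`). -/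

theorem NoOrientedCycles.isEmpty_hom (hacyc : NoOrientedCycles V) (x : V) : IsEmpty (x ⟶ x) :=
  ⟨fun a => Quiver.Path.cons_ne_nil Quiver.Path.nil a (hacyc x _)⟩

theorem NoOrientedCycles.not_path_hom (hacyc : NoOrientedCycles V) {x y : V} (p : Quiver.Path x y)
    (a : y ⟶ x) : False :=
  Quiver.Path.cons_ne_nil p a (hacyc x _)

/-- Both sides have the same last arrow, so `e` ends with `a`; what precedes `a` in `e` is a closed
path, hence trivial. -/
theorem NoOrientedCycles.eq_toPath_of_comp_toPath_eq (hacyc : NoOrientedCycles V) {x s t : V}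
    {w u : Quiver.Path x s} {a : s ⟶ t} {e : Quiver.Path s t}
    (h : w.comp a.toPath = u.comp e) : e = a.toPath := by
  cases e with
  | nil => exact ((hacyc.isEmpty_hom s).false a).elim
  | cons e b =>
    have h' : w.cons a = (u.comp e).cons b := h
    obtain rfl := Quiver.Path.obj_eq_of_cons_eq_cons h'
    obtain rfl := eq_of_heq (Quiver.Path.hom_heq_of_cons_eq_cons h')
    rw [hacyc _ e]
    rfl

/-- Mirror image of the previous lemma. Paths are built by adding arrows at the end, so common last
arrows are stripped until `v` is exhausted; `w` cannot run out first, since `v` followed by `b`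
would be a cycle. -/
theorem NoOrientedCycles.eq_toPath_of_toPath_comp_eq (hacyc : NoOrientedCycles V) {s t y : V}
    {a : s ⟶ t} {e : Quiver.Path s t} {w v : Quiver.Path t y}
    (h : a.toPath.comp w = e.comp v) : e = a.toPath := by
  induction v with
  | nil => rw [hacyc _ w] at h; exact h.symm
  | cons v b ih =>
    cases w with
    | nil => exact (hacyc.not_path_hom v b).elim
    | cons w b' =>
      have h' : (a.toPath.comp w).cons b' = (e.comp v).cons b := h
      obtain rfl := Quiver.Path.obj_eq_of_cons_eq_cons h'
      exact ih (eq_of_heq (Quiver.Path.heq_of_cons_eq_cons h'))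

/-- The complement of `a` in `ε` is a closed path, hence trivial, and there are no loops. -/
theorem NoOrientedCycles.glued_iff (hacyc : NoOrientedCycles V) (c : ParallelPair V) :
    c.Glued ↔ c.path = c.arrow.toPath := by
  constructor
  · rintro (⟨v, h⟩ | ⟨u, h⟩ | h)
    · rw [h, hacyc _ v, Quiver.Path.comp_nil]
    · rw [h, hacyc _ u, Quiver.Path.nil_comp]
    · obtain ⟨s, t, a, e⟩ := c
      obtain rfl := Quiver.Path.eq_of_length_zero e h
      exact ((hacyc.isEmpty_hom s).false a).elim
  · intro h
    exact Or.inl ⟨Quiver.Path.nil, by rw [h, Quiver.Path.comp_nil]⟩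

theorem NoOrientedCycles.finite_qPath [Finite V] [∀ x y : V, Finite (x ⟶ y)]
    (hacyc : NoOrientedCycles V) : Finite (QPath V) := by
  -- Being joined by a nontrivial path is a strict order on a finite set, hence well founded. The
  -- paths ending at `y` are then counted by induction on `y`, by removing the last arrow.
  let r : V → V → Prop := fun x y => ∃ p : Quiver.Path x y, p.length ≠ 0
  have : IsTrans V r := ⟨fun x y z ⟨p, hp⟩ ⟨q, _⟩ => ⟨p.comp q, by
    rw [Quiver.Path.length_comp]; omega⟩⟩
  have : Std.Irrefl r := ⟨fun x ⟨p, hp⟩ => hp (by rw [hacyc x p]; rfl)⟩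
  have hwf : WellFounded r := Finite.wellFounded_of_trans_of_irrefl r
  have hfin : ∀ y : V, Finite (Σ x, Quiver.Path x y) := by
    intro y
    induction y using hwf.induction with
    | _ y ih =>
      have : ∀ z : {z // r z y}, Finite (Σ x, Quiver.Path x z.1) := fun z => ih z.1 z.2
      let f : Unit ⊕ (Σ z : {z // r z y}, (z.1 ⟶ y) × (Σ x, Quiver.Path x z.1)) →
          (Σ x, Quiver.Path x y) :=
        Sum.elim (fun _ => ⟨y, Quiver.Path.nil⟩) (fun q => ⟨q.2.2.1, q.2.2.2.cons q.2.1⟩)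
      refine Finite.of_surjective f ?_
      rintro ⟨x, p⟩
      cases p with
      | nil => exact ⟨Sum.inl (), rfl⟩
      | @cons z _ p a => exact ⟨Sum.inr ⟨⟨z, a.toPath, one_ne_zero⟩, a, x, p⟩, rfl⟩
  refine Finite.of_surjective
    (fun q : (Σ y, Σ x, Quiver.Path x y) => (⟨q.2.1, q.1, q.2.2⟩ : QPath V)) ?_
  rintro ⟨x, y, p⟩
  exact ⟨⟨y, x, p⟩, rfl⟩

theorem finite_path [Finite (QPath V)] (x y : V) : Finite (Quiver.Path x y) :=
  Finite.of_injective (fun p => (⟨x, y, p⟩ : QPath V)) fun p q h => by simpa using h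

theorem finite_parallelPair [Finite V] [∀ x y : V, Finite (x ⟶ y)] [Finite (QPath V)] :
    Finite (ParallelPair V) := by
  have := fun x y : V => finite_path x y
  refine Finite.of_surjective
    (fun q : (Σ x : V, Σ y : V, (x ⟶ y) × Quiver.Path x y) =>
      (⟨q.1, q.2.1, q.2.2.1, q.2.2.2⟩ : ParallelPair V)) ?_
  rintro ⟨x, y, a, p⟩
  exact ⟨⟨x, y, a, p⟩, rfl⟩

/-! ### Paths avoiding a set of paths -/

variable {Z : Set (QPath V)}

theorem mem_avoidingPaths_of_comp {w x y z : V} {u : Quiver.Path w x} {p : Quiver.Path x y}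
    {v : Quiver.Path y z} (h : (⟨w, z, (u.comp p).comp v⟩ : QPath V) ∈ avoidingPaths Z) :
    (⟨x, y, p⟩ : QPath V) ∈ avoidingPaths Z := by
  rintro ⟨s, t, q⟩ hq ⟨u', v', huv⟩
  refine h _ hq ⟨u.comp u', v'.comp v, ?_⟩
  change p = (u'.comp q).comp v' at huv
  simp only [huv, Quiver.Path.comp_assoc]

theorem mem_avoidingPaths_of_comp_left {x y z : V} {u : Quiver.Path x y} {v : Quiver.Path y z}
    (h : (⟨x, z, u.comp v⟩ : QPath V) ∈ avoidingPaths Z) :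
    (⟨x, y, u⟩ : QPath V) ∈ avoidingPaths Z :=
  mem_avoidingPaths_of_comp (u := Quiver.Path.nil) (v := v) (by rwa [Quiver.Path.nil_comp])

theorem mem_avoidingPaths_of_comp_right {x y z : V} {u : Quiver.Path x y} {v : Quiver.Path y z}
    (h : (⟨x, z, u.comp v⟩ : QPath V) ∈ avoidingPaths Z) :
    (⟨y, z, v⟩ : QPath V) ∈ avoidingPaths Z :=
  mem_avoidingPaths_of_comp (u := u) (v := Quiver.Path.nil) (by rwa [Quiver.Path.comp_nil])

theorem not_mem_avoidingPaths {z : QPath V} (hz : z ∈ Z) : z ∉ avoidingPaths Z :=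
  fun h => h z hz ⟨Quiver.Path.nil, Quiver.Path.nil, by simp⟩

theorem mem_avoidingPaths_of_length_le_one (hlen : ∀ z ∈ Z, 2 ≤ z.path.length) {p : QPath V}
    (hp : p.path.length ≤ 1) : p ∈ avoidingPaths Z := by
  rintro z hz ⟨u, v, huv⟩
  have := hlen z hz
  rw [huv, Quiver.Path.length_comp, Quiver.Path.length_comp] at hp
  omega

end Paths

/-! ### The basis of a monomial algebra -/

section MonomialBasis

variable (k : Type*) {V : Type*} [Field k] [Quiver V] [Fintype V] (Z : Set (QPath V))

/-- The class of a path in the monomial algebra. -/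
noncomputable def pathClass {x y : V} (p : Quiver.Path x y) : MonomialAlgebra k Z :=
  (TwoSidedIdeal.span (PathAlgebra.ofPath k '' Z)).ringCon.mkₐ (α := k)
    (PathAlgebra.ofPath k ⟨x, y, p⟩)

theorem pathClass_mul_pathClass {x y z : V} (q : Quiver.Path y z) (p : Quiver.Path x y) :
    pathClass k Z q * pathClass k Z p = pathClass k Z (p.comp q) := by
  rw [pathClass, pathClass, ← map_mul, PathAlgebra.ofPath_mul_comp]
  rfl

theorem pathClass_mul_pathClass_of_ne {w x y z : V} (q : Quiver.Path y z) (p : Quiver.Path w x)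
    (h : x ≠ y) : pathClass k Z q * pathClass k Z p = 0 := by
  rw [pathClass, pathClass, ← map_mul, PathAlgebra.ofPath_mul_of_ne k h, map_zero]

theorem nil_mul_pathClass {x y : V} (p : Quiver.Path x y) :
    pathClass k Z (Quiver.Path.nil : Quiver.Path y y) * pathClass k Z p = pathClass k Z p := by
  rw [pathClass_mul_pathClass, Quiver.Path.comp_nil]

theorem pathClass_mul_nil {x y : V} (p : Quiver.Path x y) :
    pathClass k Z p * pathClass k Z (Quiver.Path.nil : Quiver.Path x x) = pathClass k Z p := by
  rw [pathClass_mul_pathClass, Quiver.Path.nil_comp]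

theorem one_eq_sum_pathClass :
    (1 : MonomialAlgebra k Z) = ∑ x : V, pathClass k Z (Quiver.Path.nil : Quiver.Path x x) := by
  rw [← map_one ((TwoSidedIdeal.span (PathAlgebra.ofPath k '' Z)).ringCon.mkₐ (α := k)),
    PathAlgebra.one_def, map_sum]
  rfl

theorem pathClass_eq_zero {x y : V} {p : Quiver.Path x y}
    (h : (⟨x, y, p⟩ : QPath V) ∉ avoidingPaths Z) : pathClass k Z p = 0 := by
  simp only [avoidingPaths, Set.mem_ofPred_eq, not_forall, not_not] at h
  obtain ⟨z, hz, u, v, huv⟩ := h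
  change p = (u.comp z.path).comp v at huv
  have h0 : pathClass k Z z.path = 0 := by
    have hmem : PathAlgebra.ofPath k z ∈ TwoSidedIdeal.span (PathAlgebra.ofPath k '' Z) :=
      TwoSidedIdeal.subset_span ⟨z, hz, rfl⟩
    have := (TwoSidedIdeal.mem_iff _ _).1 hmem
    exact (RingCon.eq _).2 this
  rw [huv, ← pathClass_mul_pathClass, ← pathClass_mul_pathClass, h0, zero_mul, mul_zero]

variable {k Z} in
theorem MonomialAlgebra.linearMap_ext {M : Type*} [AddCommMonoid M] [Module k M]
    {f g : MonomialAlgebra k Z →ₗ[k] M}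
    (h : ∀ (x y : V) (p : Quiver.Path x y), f (pathClass k Z p) = g (pathClass k Z p)) :
    f = g := by
  have hs := RingCon.mkₐ_surjective (α := k)
    (TwoSidedIdeal.span (PathAlgebra.ofPath k '' Z)).ringCon
  have : f ∘ₗ (RingCon.mkₐ (α := k) _).toLinearMap = g ∘ₗ (RingCon.mkₐ (α := k) _).toLinearMap :=
    (PathAlgebra.basis k).ext fun p => h p.source p.target p.path
  ext a
  obtain ⟨b, rfl⟩ := hs a
  exact LinearMap.congr_fun this b

/-- The two-sided ideal of the linear combinations of paths which contain a path of `Z`. -/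
noncomputable def nonAvoidingIdeal : TwoSidedIdeal (PathAlgebra k V) :=
  let S : Submodule k (PathAlgebra k V) :=
    Submodule.span k (PathAlgebra.ofPath k '' (avoidingPaths Z)ᶜ)
  have hofPath : ∀ p : QPath V, p ∉ avoidingPaths Z → PathAlgebra.ofPath k p ∈ S := fun p hp =>
    Submodule.subset_span ⟨p, hp, rfl⟩
  TwoSidedIdeal.mk' (S : Set (PathAlgebra k V)) S.zero_mem S.add_mem S.neg_mem
    (by
      intro g f hf
      change f ∈ S at hf
      change g * f ∈ S
      induction hf using Submodule.span_induction with
      | zero => rw [mul_zero]; exact S.zero_mem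
      | add f₁ f₂ _ _ h₁ h₂ => rw [mul_add]; exact S.add_mem h₁ h₂
      | smul c f _ h => rw [mul_smul_comm]; exact S.smul_mem c h
      | mem f hf =>
        obtain ⟨p, hp, rfl⟩ := hf
        refine PathAlgebra.induction_on (P := fun g => g * _ ∈ S) k g ?_ ?_ ?_
        · rw [zero_mul]; exact S.zero_mem
        · intro g₁ g₂ h₁ h₂
          rw [add_mul]; exact S.add_mem h₁ h₂
        · rintro c ⟨s, t, q⟩
          rw [smul_mul_assoc]
          refine S.smul_mem c ?_
          obtain ⟨s', t', p⟩ := p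
          by_cases h : t' = s
          · subst h
            rw [PathAlgebra.ofPath_mul_comp]
            exact hofPath _ fun h => hp (mem_avoidingPaths_of_comp_left h)
          · rw [PathAlgebra.ofPath_mul_of_ne k h]
            exact S.zero_mem)
    (by
      intro f g hf
      change f ∈ S at hf
      change f * g ∈ S
      induction hf using Submodule.span_induction with
      | zero => rw [zero_mul]; exact S.zero_mem
      | add f₁ f₂ _ _ h₁ h₂ => rw [add_mul]; exact S.add_mem h₁ h₂
      | smul c f _ h => rw [smul_mul_assoc]; exact S.smul_mem c h
      | mem f hf =>
        obtain ⟨p, hp, rfl⟩ := hf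
        refine PathAlgebra.induction_on (P := fun g => _ * g ∈ S) k g ?_ ?_ ?_
        · rw [mul_zero]; exact S.zero_mem
        · intro g₁ g₂ h₁ h₂
          rw [mul_add]; exact S.add_mem h₁ h₂
        · rintro c ⟨s, t, q⟩
          rw [mul_smul_comm]
          refine S.smul_mem c ?_
          obtain ⟨s', t', p⟩ := p
          by_cases h : t = s'
          · subst h
            rw [PathAlgebra.ofPath_mul_comp]
            exact hofPath _ fun h => hp (mem_avoidingPaths_of_comp_right h)
          · rw [PathAlgebra.ofPath_mul_of_ne k h]
            exact S.zero_mem)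

theorem mem_nonAvoidingIdeal (f : PathAlgebra k V) : f ∈ nonAvoidingIdeal k Z ↔
    f ∈ Submodule.span k (PathAlgebra.ofPath k '' (avoidingPaths Z)ᶜ) := by
  simp only [nonAvoidingIdeal, TwoSidedIdeal.mem_mk', SetLike.mem_coe]

theorem span_le_nonAvoidingIdeal :
    TwoSidedIdeal.span (PathAlgebra.ofPath k '' Z) ≤ nonAvoidingIdeal k Z := by
  rw [TwoSidedIdeal.span_le]
  rintro _ ⟨z, hz, rfl⟩
  exact (mem_nonAvoidingIdeal k Z _).2
    (Submodule.subset_span ⟨z, not_mem_avoidingPaths hz, rfl⟩)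

/-- The kernel of the projection lies in the span of the paths outside `B`, and spans of
complementary parts of a basis meet only in zero. -/
theorem linearIndependent_pathClass :
    LinearIndependent k (fun b : avoidingPaths Z => pathClass k Z b.1.path) := by
  let π := (RingCon.mkₐ (α := k)
    (TwoSidedIdeal.span (PathAlgebra.ofPath k '' Z)).ringCon).toLinearMap
  have hli : LinearIndependent k (PathAlgebra.basis k : QPath V → PathAlgebra k V) :=
    (PathAlgebra.basis k).linearIndependent
  have hker : LinearMap.ker π ≤
      Submodule.span k (PathAlgebra.ofPath k '' (avoidingPaths Z)ᶜ) := by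
    intro f hf
    rw [← mem_nonAvoidingIdeal]
    exact span_le_nonAvoidingIdeal k Z ((TwoSidedIdeal.mem_iff _ _).2 ((RingCon.eq _).1 hf))
  have hdisj := hli.disjoint_span_image (s := avoidingPaths Z) (t := (avoidingPaths Z)ᶜ)
    disjoint_compl_right
  refine (hli.comp (Subtype.val : avoidingPaths Z → QPath V) Subtype.val_injective).map (f := π) ?_
  rw [Set.range_comp, Subtype.range_val]
  exact hdisj.mono_right hker

/-- The classes of the paths which do not contain any path of `Z` form a basis of the monomial
algebra. -/
noncomputable def monomialBasis : Module.Basis (avoidingPaths Z) k (MonomialAlgebra k Z) :=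
  Module.Basis.mk (linearIndependent_pathClass k Z) (by
    set W := Submodule.span k (Set.range fun b : avoidingPaths Z => pathClass k Z b.1.path)
    -- Spanning: the quotient map by `W` kills every path, those outside `B` having zero class
    -- already.
    have h : W.mkQ = 0 := MonomialAlgebra.linearMap_ext fun x y p => by
      rw [LinearMap.zero_apply, Submodule.mkQ_apply, Submodule.Quotient.mk_eq_zero]
      by_cases hp : (⟨x, y, p⟩ : QPath V) ∈ avoidingPaths Z
      · exact Submodule.subset_span ⟨⟨_, hp⟩, rfl⟩
      · rw [pathClass_eq_zero k Z hp]
        exact W.zero_mem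
    rw [← Submodule.ker_mkQ W, h, LinearMap.ker_zero])

theorem monomialBasis_apply (b : avoidingPaths Z) :
    monomialBasis k Z b = pathClass k Z b.1.path := by
  rw [monomialBasis, Module.Basis.mk_apply]

open Classical in
theorem coord_pathClass (b : avoidingPaths Z) {x y : V} (p : Quiver.Path x y) :
    (monomialBasis k Z).coord b (pathClass k Z p) = if (⟨x, y, p⟩ : QPath V) = b then 1 else 0 := by
  by_cases hp : (⟨x, y, p⟩ : QPath V) ∈ avoidingPaths Z
  · have : pathClass k Z p = monomialBasis k Z ⟨_, hp⟩ := (monomialBasis_apply k Z ⟨_, hp⟩).symm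
    rw [this, Module.Basis.coord_apply, Module.Basis.repr_self, Finsupp.single_apply]
    exact if_congr (by rw [Subtype.ext_iff]) rfl rfl
  · rw [pathClass_eq_zero k Z hp, map_zero, if_neg]
    rintro h
    exact hp (h ▸ b.2)

theorem pathClass_ne_zero {x y : V} {p : Quiver.Path x y}
    (h : (⟨x, y, p⟩ : QPath V) ∈ avoidingPaths Z) : pathClass k Z p ≠ 0 := by
  have := (monomialBasis k Z).ne_zero ⟨_, h⟩
  rwa [monomialBasis_apply] at this

open Classical in
-- Left multiplication by the vertex `y` is the projection onto the basis paths ending at `y`.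
theorem coord_nil_mul (b : avoidingPaths Z) (y : V) (a : MonomialAlgebra k Z) :
    (monomialBasis k Z).coord b (pathClass k Z (Quiver.Path.nil : Quiver.Path y y) * a) =
      if b.1.target = y then (monomialBasis k Z).coord b a else 0 := by
  have : (monomialBasis k Z).coord b ∘ₗ
      LinearMap.mulLeft k (pathClass k Z (Quiver.Path.nil : Quiver.Path y y)) =
      (if b.1.target = y then (1 : k) else 0) • (monomialBasis k Z).coord b := by
    refine MonomialAlgebra.linearMap_ext fun s t p => ?_
    rw [LinearMap.comp_apply, LinearMap.mulLeft_apply, LinearMap.smul_apply]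
    by_cases h : t = y
    · subst h
      rw [nil_mul_pathClass, coord_pathClass]
      split_ifs with h₁ h₂
      · simp
      · exact (h₂ (by rw [← h₁])).elim
      · simp
      · simp
    · rw [pathClass_mul_pathClass_of_ne k Z _ _ h, map_zero, coord_pathClass]
      split_ifs with h₁ h₂
      · exact (h (by rw [← h₁, ← h₂])).elim
      all_goals simp
  refine (LinearMap.congr_fun this a).trans ?_
  rw [LinearMap.smul_apply]
  split_ifs <;> simp

open Classical in
theorem coord_mul_nil (b : avoidingPaths Z) (x : V) (a : MonomialAlgebra k Z) :
    (monomialBasis k Z).coord b (a * pathClass k Z (Quiver.Path.nil : Quiver.Path x x)) =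
      if b.1.source = x then (monomialBasis k Z).coord b a else 0 := by
  have : (monomialBasis k Z).coord b ∘ₗ
      LinearMap.mulRight k (pathClass k Z (Quiver.Path.nil : Quiver.Path x x)) =
      (if b.1.source = x then (1 : k) else 0) • (monomialBasis k Z).coord b := by
    refine MonomialAlgebra.linearMap_ext fun s t p => ?_
    rw [LinearMap.comp_apply, LinearMap.mulRight_apply, LinearMap.smul_apply]
    by_cases h : x = s
    · subst h
      rw [pathClass_mul_nil, coord_pathClass]
      split_ifs with h₁ h₂
      · simp
      · exact (h₂ (by rw [← h₁])).elim
      · simp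
      · simp
    · rw [pathClass_mul_pathClass_of_ne k Z _ _ h, map_zero, coord_pathClass]
      split_ifs with h₁ h₂
      · exact (h (by rw [← h₁, ← h₂])).elim
      all_goals simp
  refine (LinearMap.congr_fun this a).trans ?_
  rw [LinearMap.smul_apply]
  split_ifs <;> simp

end MonomialBasis

/-! ### Derivations of a monomial algebra -/

section Derivations

variable {k : Type*} {V : Type*} [Field k] [Quiver V] [Fintype V] {Z : Set (QPath V)}

theorem derivationSpace_map_mul {A : Type*} [Ring A] [Algebra k A] (D : derivationSpace k A A)
    (a b : A) : D.1 (a * b) = a * D.1 b + D.1 a * b :=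
  D.2 a b

theorem derivationSpace.monomial_ext
    {D D' : derivationSpace k (MonomialAlgebra k Z) (MonomialAlgebra k Z)}
    (hv : ∀ x : V, D.1 (pathClass k Z (Quiver.Path.nil : Quiver.Path x x)) =
      D'.1 (pathClass k Z (Quiver.Path.nil : Quiver.Path x x)))
    (ha : ∀ (x y : V) (a : x ⟶ y), D.1 (pathClass k Z a.toPath) = D'.1 (pathClass k Z a.toPath)) :
    D = D' := by
  refine Subtype.ext (MonomialAlgebra.linearMap_ext fun x y p => ?_)
  induction p with
  | nil => exact hv x
  | cons p a ih =>
    rw [← Quiver.Path.comp_toPath_eq_cons, ← pathClass_mul_pathClass, derivationSpace_map_mul D, derivationSpace_map_mul D', ih, ha]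

variable (F : ∀ x y : V, (x ⟶ y) → MonomialAlgebra k Z)

/-- The extension to paths, by the Leibniz rule, of a map defined on arrows. -/
noncomputable def leibnizPath {x : V} : ∀ {y : V}, Quiver.Path x y → MonomialAlgebra k Z
  | _, .nil => 0
  | _, .cons p a => pathClass k Z a.toPath * leibnizPath p + F _ _ a * pathClass k Z p

theorem leibnizPath_nil (x : V) : leibnizPath F (Quiver.Path.nil : Quiver.Path x x) = 0 := rfl

theorem leibnizPath_cons {x y z : V} (p : Quiver.Path x y) (a : y ⟶ z) :
    leibnizPath F (p.cons a) =
      pathClass k Z a.toPath * leibnizPath F p + F _ _ a * pathClass k Z p := rfl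

variable {F}

theorem nil_mul_leibnizPath
    (hl : ∀ x y a, pathClass k Z (Quiver.Path.nil : Quiver.Path y y) * F x y a = F x y a)
    {x y : V} (p : Quiver.Path x y) :
    pathClass k Z (Quiver.Path.nil : Quiver.Path y y) * leibnizPath F p = leibnizPath F p := by
  cases p with
  | nil => rw [leibnizPath_nil, mul_zero]
  | cons p a => rw [leibnizPath_cons, mul_add, ← mul_assoc, ← mul_assoc, nil_mul_pathClass, hl]

/-- No condition on `F` is needed here: each term of the expansion has as right factor the class of
a path starting at `x`. -/
theorem leibnizPath_mul_nil {x y : V} (p : Quiver.Path x y) :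
    leibnizPath F p * pathClass k Z (Quiver.Path.nil : Quiver.Path x x) = leibnizPath F p := by
  induction p with
  | nil => rw [leibnizPath_nil, zero_mul]
  | cons p a ih => rw [leibnizPath_cons, add_mul, mul_assoc, mul_assoc, pathClass_mul_nil, ih]

theorem leibnizPath_comp
    (hl : ∀ x y a, pathClass k Z (Quiver.Path.nil : Quiver.Path y y) * F x y a = F x y a)
    {x y z : V} (p : Quiver.Path x y) (q : Quiver.Path y z) :
    leibnizPath F (p.comp q) =
      pathClass k Z q * leibnizPath F p + leibnizPath F q * pathClass k Z p := by
  induction q with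
  | nil => rw [Quiver.Path.comp_nil, nil_mul_leibnizPath hl, leibnizPath_nil, zero_mul, add_zero]
  | cons q a ih =>
    rw [Quiver.Path.comp_cons, leibnizPath_cons, leibnizPath_cons, ih, mul_add, add_mul,
      ← pathClass_mul_pathClass, ← Quiver.Path.comp_toPath_eq_cons q a, ← pathClass_mul_pathClass]
    simp only [mul_assoc, add_assoc]

/-- A map defined on arrows whose extension to paths vanishes on `Z` extends to a derivation of the
monomial algebra. -/
theorem exists_derivation_of_leibnizPath
    (hl : ∀ x y a, pathClass k Z (Quiver.Path.nil : Quiver.Path y y) * F x y a = F x y a)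
    (hZ : ∀ z ∈ Z, leibnizPath F z.path = 0) :
    ∃ D : derivationSpace k (MonomialAlgebra k Z) (MonomialAlgebra k Z),
      ∀ (x y : V) (p : Quiver.Path x y), D.1 (pathClass k Z p) = leibnizPath F p := by
  let f : MonomialAlgebra k Z →ₗ[k] MonomialAlgebra k Z :=
    (monomialBasis k Z).constr k fun b => leibnizPath F b.1.path
  have hf : ∀ (x y : V) (p : Quiver.Path x y), f (pathClass k Z p) = leibnizPath F p := by
    intro x y p
    by_cases hp : (⟨x, y, p⟩ : QPath V) ∈ avoidingPaths Z
    · have h := (monomialBasis k Z).constr_basis k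
        (fun b : avoidingPaths Z => leibnizPath F b.1.path) ⟨_, hp⟩
      rwa [monomialBasis_apply] at h
    · rw [pathClass_eq_zero k Z hp, map_zero]
      simp only [avoidingPaths, Set.mem_ofPred_eq, not_forall, not_not] at hp
      obtain ⟨z, hz, u, v, huv⟩ := hp
      change p = (u.comp z.path).comp v at huv
      -- Each Leibniz term has a factor which is the class of `z` or its extension `leibnizPath F
      -- z.path`; both vanish.
      rw [huv, leibnizPath_comp hl, leibnizPath_comp hl, ← pathClass_mul_pathClass,
        pathClass_eq_zero k Z (not_mem_avoidingPaths hz), hZ z hz]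
      simp
  have hmul : (LinearMap.mul k (MonomialAlgebra k Z)).compr₂ f =
      (LinearMap.mul k (MonomialAlgebra k Z)).compl₂ f +
        (LinearMap.mul k (MonomialAlgebra k Z)).comp f := by
    refine MonomialAlgebra.linearMap_ext fun s t q => MonomialAlgebra.linearMap_ext fun x y p => ?_
    simp only [LinearMap.compr₂_apply, LinearMap.add_apply, LinearMap.compl₂_apply,
      LinearMap.comp_apply, LinearMap.mul_apply', hf]
    by_cases h : y = s
    · subst h
      rw [pathClass_mul_pathClass, hf, leibnizPath_comp hl]
    -- For non composable paths, the vertices `s` and `y` are inserted between the factors of each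
    -- term, and their product is zero.
    · rw [pathClass_mul_pathClass_of_ne k Z _ _ h, map_zero, ← pathClass_mul_nil k Z q,
        ← nil_mul_leibnizPath hl p, ← nil_mul_pathClass k Z p, ← leibnizPath_mul_nil q]
      have h0 := pathClass_mul_pathClass_of_ne k Z (Quiver.Path.nil : Quiver.Path s s)
        (Quiver.Path.nil : Quiver.Path y y) h
      rw [mul_assoc, ← mul_assoc (pathClass k Z Quiver.Path.nil), mul_assoc (leibnizPath F q),
        ← mul_assoc (pathClass k Z (Quiver.Path.nil : Quiver.Path s s)), h0]
      simp
  refine ⟨⟨f, fun a b => ?_⟩, hf⟩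
  exact LinearMap.congr_fun (LinearMap.congr_fun hmul a) b

/-! ### Coordinates of products -/

variable {w x y z : V} {u : Quiver.Path w x} {e : Quiver.Path x y} {v : Quiver.Path y z}

/-- Concatenation with `u` and `v` is injective on paths, so `u e v` can only come from `e`. -/
theorem coord_mul_mul (h : (⟨w, z, (u.comp e).comp v⟩ : QPath V) ∈ avoidingPaths Z)
    (b : MonomialAlgebra k Z) :
    (monomialBasis k Z).coord ⟨_, h⟩ (pathClass k Z v * b * pathClass k Z u) =
      (monomialBasis k Z).coord ⟨⟨x, y, e⟩, mem_avoidingPaths_of_comp h⟩ b := by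
  classical
  have : (monomialBasis k Z).coord ⟨_, h⟩ ∘ₗ LinearMap.mulRight k (pathClass k Z u) ∘ₗ
      LinearMap.mulLeft k (pathClass k Z v) =
      (monomialBasis k Z).coord ⟨⟨x, y, e⟩, mem_avoidingPaths_of_comp h⟩ := by
    refine MonomialAlgebra.linearMap_ext fun s t q => ?_
    simp only [LinearMap.comp_apply, LinearMap.mulRight_apply, LinearMap.mulLeft_apply]
    by_cases ht : t = y
    · subst ht
      by_cases hs : x = s
      · subst hs
        rw [pathClass_mul_pathClass, pathClass_mul_pathClass, coord_pathClass, coord_pathClass,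
          ← Quiver.Path.comp_assoc]
        refine if_congr ?_ rfl rfl
        simp [Quiver.Path.comp_inj_left, Quiver.Path.comp_inj_right]
      · rw [pathClass_mul_pathClass, pathClass_mul_pathClass_of_ne k Z _ _ hs, map_zero,
          coord_pathClass, if_neg]
        intro h
        exact hs (congrArg QPath.source h).symm
    · rw [pathClass_mul_pathClass_of_ne k Z _ _ ht, zero_mul, map_zero, coord_pathClass, if_neg]
      intro h
      exact ht (congrArg QPath.target h)
  exact LinearMap.congr_fun this b

/-- Only paths starting with `u a` occur in the product; if `u e v` were one of them, acyclicity
would force `e = a`. -/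
theorem coord_mul_arrow_mul (hacyc : NoOrientedCycles V)
    (h : (⟨w, z, (u.comp e).comp v⟩ : QPath V) ∈ avoidingPaths Z) {a : x ⟶ y}
    (hne : e ≠ a.toPath) (b : MonomialAlgebra k Z) :
    (monomialBasis k Z).coord ⟨_, h⟩ (b * (pathClass k Z a.toPath * pathClass k Z u)) = 0 := by
  have : (monomialBasis k Z).coord ⟨_, h⟩ ∘ₗ
      LinearMap.mulRight k (pathClass k Z a.toPath * pathClass k Z u) = 0 := by
    refine MonomialAlgebra.linearMap_ext fun s t q => ?_
    rw [LinearMap.comp_apply, LinearMap.mulRight_apply, LinearMap.zero_apply,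
      pathClass_mul_pathClass]
    by_cases hs : y = s
    · subst hs
      rw [pathClass_mul_pathClass, coord_pathClass, if_neg]
      intro h
      obtain rfl : t = z := congrArg QPath.target h
      simp only [QPath.mk.injEq, heq_eq_eq, true_and, Quiver.Path.comp_assoc,
        Quiver.Path.comp_inj_right] at h
      exact hne (hacyc.eq_toPath_of_toPath_comp_eq h)
    · rw [pathClass_mul_pathClass_of_ne k Z _ _ hs, map_zero]
  exact LinearMap.congr_fun this b

theorem coord_mul_arrow_mul' (hacyc : NoOrientedCycles V)
    (h : (⟨w, z, (u.comp e).comp v⟩ : QPath V) ∈ avoidingPaths Z) {a : x ⟶ y}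
    (hne : e ≠ a.toPath) (b : MonomialAlgebra k Z) :
    (monomialBasis k Z).coord ⟨_, h⟩ (pathClass k Z v * pathClass k Z a.toPath * b) = 0 := by
  have : (monomialBasis k Z).coord ⟨_, h⟩ ∘ₗ
      LinearMap.mulLeft k (pathClass k Z v * pathClass k Z a.toPath) = 0 := by
    refine MonomialAlgebra.linearMap_ext fun s t q => ?_
    rw [LinearMap.comp_apply, LinearMap.mulLeft_apply, LinearMap.zero_apply,
      pathClass_mul_pathClass]
    by_cases ht : t = x
    · subst ht
      rw [pathClass_mul_pathClass, coord_pathClass, if_neg]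
      intro h
      obtain rfl : s = w := congrArg QPath.source h
      simp only [QPath.mk.injEq, heq_eq_eq, true_and, ← Quiver.Path.comp_assoc,
        Quiver.Path.comp_inj_left] at h
      exact hne (hacyc.eq_toPath_of_comp_toPath_eq h)
    · rw [pathClass_mul_pathClass_of_ne k Z _ _ ht, map_zero]
  exact LinearMap.congr_fun this b

end Derivations

section Hochschild

variable (k : Type*) (A : Type*) (X : Type*) [Field k] [Ring A] [Algebra k A]
  [AddCommGroup X] [Module k X] [Module A X] [Module Aᵐᵒᵖ X] [IsScalarTower k A X]
  [IsScalarTower k Aᵐᵒᵖ X]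

/-- The class of a derivation in the first Hochschild cohomology space. -/
def HochschildH1.mk : derivationSpace k A X →ₗ[k] HochschildH1 k A X :=
  (innerDerivations k A X).mkQ

theorem HochschildH1.mk_surjective : Function.Surjective (HochschildH1.mk k A X) :=
  Submodule.mkQ_surjective _

theorem HochschildH1.mk_eq_zero_iff (D : derivationSpace k A X) :
    HochschildH1.mk k A X D = 0 ↔ D ∈ innerDerivations k A X :=
  Submodule.Quotient.mk_eq_zero _

end Hochschild

/-! ### Derivations which vanish on the vertices -/

section VertexKilling

variable (k : Type*) {V : Type*} [Field k] [Quiver V] [Fintype V] (Z : Set (QPath V))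

/-- The derivations which vanish on the vertices. -/
noncomputable def vertexKilling :
    Submodule k (derivationSpace k (MonomialAlgebra k Z) (MonomialAlgebra k Z)) where
  carrier := {D | ∀ x : V, D.1 (pathClass k Z (Quiver.Path.nil : Quiver.Path x x)) = 0}
  zero_mem' _ := rfl
  add_mem' {D D'} h h' x := by
    rw [Submodule.coe_add, LinearMap.add_apply, h x, h' x, add_zero]
  smul_mem' c D h x := by rw [Submodule.coe_smul, LinearMap.smul_apply, h x, smul_zero]

/-- The coordinate on `ε` of the value of a derivation on `a`, for the pairs `(a, ε)` which are not
effective. -/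
noncomputable def arrowCoord :
    vertexKilling k Z →ₗ[k] (ParallelPair.nonEffective Z → k) where
  toFun D c := (monomialBasis k Z).coord ⟨⟨c.1.source, c.1.target, c.1.path⟩, c.2.1⟩
    (D.1.1 (pathClass k Z c.1.arrow.toPath))
  map_add' D D' := by
    ext c
    rw [Submodule.coe_add, Submodule.coe_add, LinearMap.add_apply, map_add]
    rfl
  map_smul' r D := by
    ext c
    rw [Submodule.coe_smul, Submodule.coe_smul, LinearMap.smul_apply, map_smul]
    rfl

variable {k Z}

/-- Differentiate the relation `γ = u a v = 0` and take the coordinate on `u ε v`: only the term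
where `a` is differentiated survives. -/
theorem coord_eq_zero_of_effective (hacyc : NoOrientedCycles V)
    (D : derivationSpace k (MonomialAlgebra k Z) (MonomialAlgebra k Z))
    {c : ParallelPair V} (hc : c ∈ ParallelPair.ofAvoiding Z) (heff : c.Effective Z) :
    (monomialBasis k Z).coord ⟨⟨c.source, c.target, c.path⟩, hc⟩
      (D.1 (pathClass k Z c.arrow.toPath)) = 0 := by
  obtain ⟨hglued, γ, hγ, u, v, huv, hB⟩ := heff
  rw [hacyc.glued_iff] at hglued
  have h0 : pathClass k Z v * pathClass k Z c.arrow.toPath * pathClass k Z u = 0 := by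
    rw [mul_assoc, pathClass_mul_pathClass, pathClass_mul_pathClass, ← huv]
    exact pathClass_eq_zero k Z (not_mem_avoidingPaths hγ)
  have h := congrArg ((monomialBasis k Z).coord ⟨_, hB⟩) (congrArg D.1 h0)
  rw [derivationSpace_map_mul, derivationSpace_map_mul, add_mul, map_zero, map_zero, map_add,
    map_add, mul_assoc (D.1 _), coord_mul_arrow_mul' hacyc hB hglued,
    coord_mul_arrow_mul hacyc hB hglued, zero_add, add_zero, coord_mul_mul hB] at h
  exact h

theorem arrowCoord_injective (hacyc : NoOrientedCycles V) :
    Function.Injective (arrowCoord k Z) := by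
  classical
  intro D D' hD
  refine Subtype.ext (derivationSpace.monomial_ext (fun x => (D.2 x).trans (D'.2 x).symm)
    fun x y a => (monomialBasis k Z).ext_elem fun b => ?_)
  change (monomialBasis k Z).coord b (D.1.1 _) = (monomialBasis k Z).coord b (D'.1.1 _)
  -- Since `D` kills the vertices, it commutes with multiplication by them, so only paths parallel
  -- to `a` occur in `D a`.
  have hx : ∀ D : vertexKilling k Z, D.1.1 (pathClass k Z a.toPath) =
      pathClass k Z (Quiver.Path.nil : Quiver.Path y y) *
        (D.1.1 (pathClass k Z a.toPath) * pathClass k Z (Quiver.Path.nil : Quiver.Path x x)) := by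
    intro D
    conv_lhs => rw [← nil_mul_pathClass k Z a.toPath, derivationSpace_map_mul, D.2, zero_mul,
      add_zero, ← pathClass_mul_nil k Z a.toPath, derivationSpace_map_mul, D.2, mul_zero, zero_add]
  rw [hx D, hx D', coord_nil_mul, coord_nil_mul, coord_mul_nil, coord_mul_nil]
  split_ifs with hy hx'
  · obtain ⟨⟨x, y, e⟩, hb⟩ := b
    obtain rfl : y = _ := hy
    obtain rfl : x = _ := hx'
    let c : ParallelPair V := ⟨x, y, a, e⟩
    by_cases hc : c.Effective Z
    · exact (coord_eq_zero_of_effective hacyc D.1 (c := c) hb hc).trans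
        (coord_eq_zero_of_effective hacyc D'.1 (c := c) hb hc).symm
    · exact congrFun hD ⟨c, hb, hc⟩
  · rfl
  · rfl

theorem arrowCoord_surjective [Finite (QPath V)] (hacyc : NoOrientedCycles V) :
    Function.Surjective (arrowCoord k Z) := by
  classical
  intro c
  have := fun x y : V => finite_path x y
  have := fun x y : V => Fintype.ofFinite (Quiver.Path x y)
  -- The prescribed coefficients are extended by zero, in particular to effective pairs, so that `F`
  -- can sum over all paths parallel to `a`.
  let C : ParallelPair V → k := fun p => if h : p ∈ ParallelPair.nonEffective Z then c ⟨p, h⟩ else 0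
  let F : ∀ x y : V, (x ⟶ y) → MonomialAlgebra k Z := fun x y a =>
    ∑ e : Quiver.Path x y, C ⟨x, y, a, e⟩ • pathClass k Z e
  have hl : ∀ x y a, pathClass k Z (Quiver.Path.nil : Quiver.Path y y) * F x y a = F x y a := by
    intro x y a
    simp only [F, Finset.mul_sum, mul_smul_comm, nil_mul_pathClass]
  have hr : ∀ x y a, F x y a * pathClass k Z (Quiver.Path.nil : Quiver.Path x x) = F x y a := by
    intro x y a
    simp only [F, Finset.sum_mul, smul_mul_assoc, pathClass_mul_nil]
  -- The path `u v ∈ Z` stays fixed while the induction moves the last arrow of `u` to `v`; the case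
  -- of trivial `v` is the vanishing on `Z`.
  have hprefix : ∀ {x y : V} (u : Quiver.Path x y) {t : V} (v : Quiver.Path y t),
      (⟨x, t, u.comp v⟩ : QPath V) ∈ Z → pathClass k Z v * leibnizPath F u = 0 := by
    intro x y u
    induction u with
    | nil => intro t v _; rw [leibnizPath_nil, mul_zero]
    | @cons y z u a ih =>
      intro t v h
      have h' : (⟨x, t, u.comp (a.toPath.comp v)⟩ : QPath V) ∈ Z := by
        rwa [← Quiver.Path.comp_assoc]
      rw [leibnizPath_cons, mul_add, ← mul_assoc, pathClass_mul_pathClass, ih _ h', zero_add]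
      simp only [F, Finset.sum_mul, Finset.mul_sum, smul_mul_assoc, mul_smul_comm]
      refine Finset.sum_eq_zero fun e _ => ?_
      by_cases he : (⟨y, z, a, e⟩ : ParallelPair V) ∈ ParallelPair.nonEffective Z
      · rw [pathClass_mul_pathClass, pathClass_mul_pathClass, pathClass_eq_zero k Z, smul_zero]
        intro hB
        -- If `u e v` were in `B`, the pair would be effective unless glued; a glued pair has `e =
        -- a`, and then `u e v` is in `Z`.
        refine he.2 ⟨fun hg => ?_, _, h, u, v, rfl, hB⟩
        rw [hacyc.glued_iff] at hg
        change e = a.toPath at hg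
        subst hg
        exact not_mem_avoidingPaths h hB
      · simp only [C, dif_neg he, zero_smul]
  obtain ⟨D, hD⟩ := exists_derivation_of_leibnizPath hl fun z hz => by
    have := hprefix z.path Quiver.Path.nil hz
    rwa [nil_mul_leibnizPath hl] at this
  refine ⟨⟨D, fun x => hD x x _⟩, ?_⟩
  ext ⟨⟨x, y, a, e⟩, hp⟩
  change (monomialBasis k Z).coord ⟨⟨x, y, e⟩, hp.1⟩ (D.1 (pathClass k Z a.toPath)) = _
  have hDa : D.1 (pathClass k Z a.toPath) = F x y a := by
    rw [hD]
    change _ * leibnizPath F Quiver.Path.nil + F x y a * pathClass k Z Quiver.Path.nil = _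
    rw [leibnizPath_nil, mul_zero, zero_add, hr]
  rw [hDa, map_sum, Finset.sum_eq_single e]
  · rw [map_smul, coord_pathClass, if_pos rfl]
    simp only [C, dif_pos hp, smul_eq_mul, mul_one]
  · intro e' _ hne
    rw [map_smul, coord_pathClass, if_neg, smul_zero]
    simpa using hne
  · simp

/-! ### Inner derivations -/

variable (k Z)

/-- The linear combinations of vertices. -/
noncomputable def diagonal : (V → k) →ₗ[k] MonomialAlgebra k Z :=
  Fintype.linearCombination k fun x : V => pathClass k Z (Quiver.Path.nil : Quiver.Path x x)

theorem diagonal_apply (s : V → k) :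
    diagonal k Z s = ∑ x : V, s x • pathClass k Z (Quiver.Path.nil : Quiver.Path x x) := rfl

variable {Z}

theorem pathClass_mul_diagonal (s : V → k) {x y : V} (p : Quiver.Path x y) :
    pathClass k Z p * diagonal k Z s = s x • pathClass k Z p := by
  classical
  rw [diagonal_apply, Finset.mul_sum, Finset.sum_eq_single x]
  · rw [mul_smul_comm, pathClass_mul_nil]
  · intro z _ hz
    rw [mul_smul_comm, pathClass_mul_pathClass_of_ne k Z _ _ hz, smul_zero]
  · simp

theorem diagonal_mul_pathClass (s : V → k) {x y : V} (p : Quiver.Path x y) :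
    diagonal k Z s * pathClass k Z p = s y • pathClass k Z p := by
  classical
  rw [diagonal_apply, Finset.sum_mul, Finset.sum_eq_single y]
  · rw [smul_mul_assoc, nil_mul_pathClass]
  · intro z _ hz
    rw [smul_mul_assoc, pathClass_mul_pathClass_of_ne k Z _ _ hz.symm, smul_zero]
  · simp

variable (Z)

/-- The inner derivation defined by a linear combination of vertices. -/
noncomputable def diagonalDerivation : (V → k) →ₗ[k] vertexKilling k Z where
  toFun s := ⟨⟨LinearMap.mulRight k (diagonal k Z s) - LinearMap.mulLeft k (diagonal k Z s), by
    intro a b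
    simp only [LinearMap.sub_apply, LinearMap.mulRight_apply, LinearMap.mulLeft_apply, smul_eq_mul,
      MulOpposite.smul_eq_mul_unop, MulOpposite.unop_op]
    noncomm_ring⟩, by
    intro x
    simp only [LinearMap.sub_apply, LinearMap.mulRight_apply, LinearMap.mulLeft_apply,
      pathClass_mul_diagonal, diagonal_mul_pathClass, sub_self]⟩
  map_add' s s' := by
    refine Subtype.ext (Subtype.ext (LinearMap.ext fun a => ?_))
    simp only [map_add, Submodule.coe_add, LinearMap.sub_apply, LinearMap.add_apply,
      LinearMap.mulRight_apply, LinearMap.mulLeft_apply]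
    noncomm_ring
  map_smul' c s := by
    refine Subtype.ext (Subtype.ext (LinearMap.ext fun a => ?_))
    simp only [map_smul, Submodule.coe_smul, LinearMap.sub_apply, LinearMap.smul_apply,
      LinearMap.mulRight_apply, LinearMap.mulLeft_apply, mul_smul_comm, smul_mul_assoc,
      RingHom.id_apply, smul_sub]

theorem diagonalDerivation_apply (s : V → k) (a : MonomialAlgebra k Z) :
    (diagonalDerivation k Z s).1.1 a = a * diagonal k Z s - diagonal k Z s * a := rfl

/-- An arrow from `x` to `y` is multiplied by `s x - s y`, and its class is nonzero because paths of
`Z` have length at least two; so `s` is constant along zigzags. -/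
theorem ker_diagonalDerivation (hconn : QuiverConnected V) (hlen : ∀ z ∈ Z, 2 ≤ z.path.length) :
    LinearMap.ker (diagonalDerivation k Z) = Submodule.span k {(1 : V → k)} := by
  ext s
  rw [LinearMap.mem_ker, Submodule.mem_span_singleton]
  constructor
  · intro hs
    have harrow : ∀ {x y : V}, (x ⟶ y) → s x = s y := by
      intro x y a
      have h : (diagonalDerivation k Z s).1.1 (pathClass k Z a.toPath) = 0 := by rw [hs]; rfl
      rw [diagonalDerivation_apply, pathClass_mul_diagonal, diagonal_mul_pathClass, ← sub_smul,
        smul_eq_zero] at h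
      refine sub_eq_zero.1 (h.resolve_right (pathClass_ne_zero k Z ?_))
      exact mem_avoidingPaths_of_length_le_one hlen le_rfl
    obtain ⟨⟨x⟩, hpath⟩ := hconn
    refine ⟨s x, funext fun y => ?_⟩
    rw [Pi.smul_apply, Pi.one_apply, smul_eq_mul, mul_one]
    obtain ⟨p⟩ := hpath x y
    induction p with
    | nil => rfl
    | cons _ a ih =>
      rw [ih]
      rcases a with a | a
      · exact harrow a
      · exact (harrow a).symm
  · rintro ⟨c, rfl⟩
    refine Subtype.ext (derivationSpace.monomial_ext ?_ ?_)
    · intro x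
      rw [diagonalDerivation_apply, pathClass_mul_diagonal, diagonal_mul_pathClass, sub_self]
      rfl
    · intro x y a
      rw [diagonalDerivation_apply, pathClass_mul_diagonal, diagonal_mul_pathClass]
      simp

/-- The class in the first Hochschild cohomology of a derivation which vanishes on the vertices. -/
noncomputable def vertexKillingToH1 :
    vertexKilling k Z →ₗ[k] HochschildH1 k (MonomialAlgebra k Z) (MonomialAlgebra k Z) :=
  HochschildH1.mk k (MonomialAlgebra k Z) (MonomialAlgebra k Z) ∘ₗ
    (vertexKilling k Z).subtype

theorem vertexKillingToH1_eq_zero_iff (D : vertexKilling k Z) :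
    vertexKillingToH1 k Z D = 0 ↔
      ∃ x : MonomialAlgebra k Z, ∀ a : MonomialAlgebra k Z, D.1.1 a = a * x - x * a :=
  HochschildH1.mk_eq_zero_iff k (MonomialAlgebra k Z) (MonomialAlgebra k Z) D.1

theorem ker_vertexKillingToH1 (hacyc : NoOrientedCycles V)
    (hlen : ∀ z ∈ Z, 2 ≤ z.path.length) :
    LinearMap.ker (vertexKillingToH1 k Z) = LinearMap.range (diagonalDerivation k Z) := by
  classical
  ext D
  rw [LinearMap.mem_ker, vertexKillingToH1_eq_zero_iff, LinearMap.mem_range]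
  constructor
  · rintro ⟨m, hm⟩
    have hvertex : ∀ x : V, (⟨x, x, Quiver.Path.nil⟩ : QPath V) ∈ avoidingPaths Z := fun x =>
      mem_avoidingPaths_of_length_le_one hlen (Nat.zero_le 1)
    let s : V → k := fun x => (monomialBasis k Z).coord ⟨_, hvertex x⟩ m
    have hcomm : ∀ x : V, pathClass k Z (Quiver.Path.nil : Quiver.Path x x) * m =
        m * pathClass k Z (Quiver.Path.nil : Quiver.Path x x) := fun x =>
      sub_eq_zero.1 ((hm _).symm.trans (D.2 x))
    have hs : m = diagonal k Z s := by
      refine (monomialBasis k Z).ext_elem fun b => ?_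
      change (monomialBasis k Z).coord b m = (monomialBasis k Z).coord b (diagonal k Z s)
      obtain ⟨⟨x, y, p⟩, hb⟩ := b
      by_cases hxy : x = y
      · subst hxy
        obtain rfl := hacyc x p
        rw [diagonal_apply, map_sum, Finset.sum_eq_single x]
        · rw [map_smul, coord_pathClass, if_pos rfl, smul_eq_mul, mul_one]
        · intro z _ hz
          rw [map_smul, coord_pathClass, if_neg, smul_zero]
          exact fun h => hz (congrArg QPath.source h)
        · simp
      -- Commuting with the end vertex `y` kills the coordinate on a path that does not start at
      -- `y`.
      · have h := congrArg ((monomialBasis k Z).coord ⟨⟨x, y, p⟩, hb⟩) (hcomm y)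
        rw [coord_nil_mul, coord_mul_nil, if_pos rfl, if_neg hxy] at h
        rw [h, diagonal_apply, map_sum, Finset.sum_eq_zero]
        intro z _
        rw [map_smul, coord_pathClass, if_neg, smul_zero]
        intro h
        exact hxy ((congrArg QPath.source h).symm.trans (congrArg QPath.target h))
    refine ⟨s, Subtype.ext (Subtype.ext (LinearMap.ext fun a => ?_))⟩
    rw [diagonalDerivation_apply, hm, hs]
  · rintro ⟨s, rfl⟩
    exact ⟨diagonal k Z s, diagonalDerivation_apply k Z s⟩

theorem vertexKillingToH1_surjective : Function.Surjective (vertexKillingToH1 k Z) := by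
  classical
  intro q
  obtain ⟨D, rfl⟩ := HochschildH1.mk_surjective k _ _ q
  let e : V → MonomialAlgebra k Z := fun x => pathClass k Z (Quiver.Path.nil : Quiver.Path x x)
  have hee : ∀ x : V, e x * e x = e x := fun x => nil_mul_pathClass k Z _
  have hne : ∀ x y : V, x ≠ y → e y * e x = 0 := fun x y h =>
    pathClass_mul_pathClass_of_ne k Z _ _ h
  -- This element comes from the separability idempotent `∑ e x ⊗ e x` of the span of the vertices;
  -- its inner derivation takes the value `-D (e y)` on `e y`.
  let m : MonomialAlgebra k Z := ∑ x : V, D.1 (e x) * e x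
  obtain ⟨D', hD', hm⟩ := exists_mem_innerDerivations k (MonomialAlgebra k Z)
    (MonomialAlgebra k Z) m
  have hval : ∀ y : V, D'.1 (e y) = -D.1 (e y) := by
    intro y
    have h₁ : m * e y = D.1 (e y) * e y := by
      rw [Finset.sum_mul, Finset.sum_eq_single y]
      · rw [mul_assoc, hee]
      · intro x _ hx
        rw [mul_assoc, hne y x hx.symm, mul_zero]
      · simp
    have h₂ : e y * m = D.1 (e y) * e y - D.1 (e y) := by
      -- Differentiate `e y * e x`, which is `e y` or `0`, and multiply by `e x` on the right. For
      -- `x = y` this gives `e y * D (e y) * e y = 0`.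
      have h : ∀ x : V, e y * (D.1 (e x) * e x) =
          (if x = y then D.1 (e y) * e y else 0) - D.1 (e y) * e x := by
        intro x
        have hx := derivationSpace_map_mul D (e y) (e x)
        split_ifs with hxy
        · subst hxy
          rw [hee] at hx
          have := congrArg (· * e x) hx
          simp only [add_mul, mul_assoc, hee] at this
          rw [sub_self]
          exact left_eq_add.1 (this.trans (add_comm _ _))
        · rw [hne x y hxy, map_zero] at hx
          have := congrArg (· * e x) hx
          simp only [add_mul, mul_assoc, hee, zero_mul] at this
          rw [zero_sub]
          exact eq_neg_of_add_eq_zero_left this.symm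
      rw [Finset.mul_sum, Finset.sum_congr rfl fun x _ => h x, Finset.sum_sub_distrib,
        Finset.sum_ite_eq' Finset.univ y, if_pos (Finset.mem_univ y), ← Finset.mul_sum,
        ← one_eq_sum_pathClass, mul_one]
    rw [hm]
    change e y * m - m * e y = _
    rw [h₁, h₂]
    abel
  refine ⟨⟨D + D', fun x => ?_⟩, ?_⟩
  · rw [Submodule.coe_add, LinearMap.add_apply]
    exact (congrArg _ (hval x)).trans (add_neg_cancel _)
  · change HochschildH1.mk k _ _ (D + D') = _
    rw [map_add, (HochschildH1.mk_eq_zero_iff k _ _ D').2 hD', add_zero]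

end VertexKilling

/-! ### Dimension count along the exact sequence. -/

theorem finrank_add_card_of_ker_eq_range {k n m S H : Type*} [Field k] [Fintype n] [Fintype m]
    [AddCommMonoid S] [Module k S] [AddCommGroup H] [Module k H] (E : S ≃ₗ[k] (m → k))
    {f : (n → k) →ₗ[k] S} {g : S →ₗ[k] H} (hg : Function.Surjective g)
    (hfg : LinearMap.ker g = LinearMap.range f) :
    Module.Finite k H ∧ Module.finrank k H + Fintype.card n =
      Fintype.card m + Module.finrank k (LinearMap.ker f) := by
  -- Transport along `E` makes both sources finite dimensional coordinate spaces, to which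
  -- rank-nullity applies.
  let f' := E.toLinearMap ∘ₗ f
  let g' := g ∘ₗ E.symm.toLinearMap
  have hg' : Function.Surjective g' := hg.comp E.symm.surjective
  have hf' : LinearMap.ker f' = LinearMap.ker f := LinearEquiv.ker_comp _ _
  have hfg' : LinearMap.ker g' = LinearMap.range f' := by
    rw [LinearMap.ker_comp, hfg, LinearMap.range_comp, Submodule.map_equiv_eq_comap_symm]
  have h₁ := g'.finrank_range_add_finrank_ker
  have h₂ := f'.finrank_range_add_finrank_ker
  rw [LinearMap.range_eq_top.2 hg', finrank_top, hfg', Module.finrank_fintype_fun_eq_card] at h₁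
  rw [hf', Module.finrank_fintype_fun_eq_card] at h₂
  exact ⟨Module.Finite.of_surjective g' hg', by omega⟩

theorem theorem5p1 (k : Type*) [Field k] (V : Type*) [Quiver V] [Fintype V]
    [∀ x y : V, Finite (x ⟶ y)] (hconn : QuiverConnected V) (hacyc : NoOrientedCycles V)
    (Z : Set (QPath V)) (hmin : MinimalPaths Z) (hlen : ∀ z ∈ Z, 2 ≤ z.path.length) :
    Module.Finite k (HochschildH1 k (MonomialAlgebra k Z) (MonomialAlgebra k Z)) ∧
    (ParallelPair.nonEffective Z).Finite ∧
    (Module.finrank k (HochschildH1 k (MonomialAlgebra k Z) (MonomialAlgebra k Z)) : ℤ) =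
      1 - (Fintype.card V : ℤ) + ((ParallelPair.nonEffective Z).ncard : ℤ) := by
  have := hacyc.finite_qPath
  have := finite_parallelPair (V := V)
  have hfin : (ParallelPair.nonEffective Z).Finite := Set.toFinite _
  have : Fintype (ParallelPair.nonEffective Z) := hfin.fintype
  have : Nonempty V := hconn.1
  have h := finrank_add_card_of_ker_eq_range
    (LinearEquiv.ofBijective (arrowCoord k Z)
      ⟨arrowCoord_injective hacyc, arrowCoord_surjective hacyc⟩)
    (vertexKillingToH1_surjective k Z) (ker_vertexKillingToH1 k Z hacyc hlen)
  -- The constants contribute the summand `1`; the constant function `1` is nonzero because `V` is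
  -- nonempty.
  rw [ker_diagonalDerivation k Z hconn hlen, finrank_span_singleton one_ne_zero,
    ← Set.toFinset_card, ← Set.ncard_eq_toFinset_card'] at h
  exact ⟨h.1, hfin, by omega⟩
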